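/- Let $J$ be a semi-infinite Jacobi matrix with parameters $a_n>0$, $b_n\in\mathbb R$ ($n\ge 1$), and put $a_0=1$. For $0<|z|<1$, a Jost solution is a sequence $(\psi_n)_{n\ge 0}$ of complex numbers with $$a_{n-1}\psi_{n-1}+b_n\psi_n+a_n\psi_{n+1}=(z+z^{-1})\psi_n\quad (n\ge 1),\qquad \lim_{n\to\infty} z^{-n}\psi_n=1 .$$ The Jost function $u$ of $J$ is the analytic function on $\{|z|<1\}$ such that, for $0<|z|<1$, there is exactly one Jost solution and $u(z)=\psi_0$ for it; its analytic continuation is also denoted by $u$. Let $$B(z)=1-\sum_{n=0}^\infty\bigl[b_{n+1}z^{2n+1}+(a_{n+1}^2-1)z^{2n+2}\bigr].$$ **Theorem 1.5.** Suppose $$\limsup_{n\to\infty}\,(|a_n^2-1|+|b_n|)^{1/2n}=R^{-1}<1$$ (where $R=\infty$, $R^{-1}=0$ is allowed). Then the series for $B$ converges in $\{|z|<R\}$, the Jost function $u$ exists and is analytic in $\{|z|<R\}$, and the function $$(1-z^2)u(z)+z^2\,\overline{u(1/\bar z)}\,B(z),$$ which is thereby defined for $R^{-1}<|z|<R$, has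 an analytic continuation to the annulus $\{z : R^{-1}<|z|<R^2\}$. The radius $R^2$ is optimal: for every $1<R<\infty$ there are Jacobi parameters satisfying the displayed $\limsup$ condition with this $R$ for which, for every $\rho\in(R^2,\infty]$, this function has no analytic continuation to $\{z : R^{-1}<|z|<\rho\}$. -/

import Mathlib

open Filter Topology
open scoped ENNReal ComplexConjugate

namespace JacobiJost

/-- Jacobi parameters `a₁, a₂, …` and `b₁, b₂, …` are given as functions `a b : ℕ → ℝ`, of which only
the values at `n ≥ 1` are used. The off-diagonal coefficient, with the usual convention `a₀ = 1`. -/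
def offDiag (a : ℕ → ℝ) (n : ℕ) : ℝ := if n = 0 then 1 else a n

/-- `ψ₀, ψ₁, ψ₂, …` is a Jost solution at energy `z + z⁻¹`: it solves
`a_{n-1} ψ_{n-1} + b_n ψ_n + a_n ψ_{n+1} = (z + z⁻¹) ψ_n` for all `n ≥ 1` (with `a₀ = 1`) and
`z⁻ⁿ ψ_n → 1`. -/
def IsJostSolution (a b : ℕ → ℝ) (z : ℂ) (ψ : ℕ → ℂ) : Prop :=
  (∀ n : ℕ, (offDiag a n : ℂ) * ψ n + (b (n + 1) : ℂ) * ψ (n + 1)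
      + (offDiag a (n + 1) : ℂ) * ψ (n + 2) = (z + z⁻¹) * ψ (n + 1)) ∧
  Tendsto (fun n : ℕ => ψ n / z ^ n) atTop (𝓝 1)

/-- `u` is the Jost function of the Jacobi matrix with parameters `a, b`: it is analytic in the open
unit disk, and at each `z ≠ 0` there, a Jost solution exists, is unique, and has `u z` as its value
at index `0`. -/
def IsJostFunction (a b : ℕ → ℝ) (u : ℂ → ℂ) : Prop :=
  AnalyticOnNhd ℂ u (Metric.ball 0 1) ∧
  ∀ z : ℂ, z ≠ 0 → ‖z‖ < 1 →
    (∃! ψ : ℕ → ℂ, IsJostSolution a b z ψ) ∧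
    ∀ ψ : ℕ → ℂ, IsJostSolution a b z ψ → u z = ψ 0

/-- The `n`-th term `b_{n+1} z^{2n+1} + (a_{n+1}² - 1) z^{2n+2}`. -/
def bTerm (a b : ℕ → ℝ) (z : ℂ) (n : ℕ) : ℂ :=
  (b (n + 1) : ℂ) * z ^ (2 * n + 1) + ((a (n + 1) : ℂ) ^ 2 - 1) * z ^ (2 * n + 2)

/-- `B(z) = 1 - ∑_{n ≥ 0} [b_{n+1} z^{2n+1} + (a_{n+1}² - 1) z^{2n+2}]`. -/
noncomputable def B (a b : ℕ → ℝ) (z : ℂ) : ℂ := 1 - ∑' n : ℕ, bTerm a b z n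

/-- `limsup (|a_n² - 1| + |b_n|)^{1/2n} = R⁻¹`, where `R = ∞` (and `R⁻¹ = 0`) is allowed. -/
def HasDecayRate (a b : ℕ → ℝ) (R : ℝ≥0∞) : Prop :=
  limsup (fun n : ℕ => ENNReal.ofReal ((|a n ^ 2 - 1| + |b n|) ^ (1 / (2 * (n : ℝ))))) atTop = R⁻¹

/-- The open annulus `r < |z| < s`. -/
def annulus (r s : ℝ≥0∞) : Set ℂ := {z : ℂ | r < ‖z‖ₑ ∧ ‖z‖ₑ < s}

/-- `(1 - z²) u(z) + z² conj (u (1 / conj z)) B(z)`. -/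
noncomputable def combination (a b : ℕ → ℝ) (u : ℂ → ℂ) (z : ℂ) : ℂ :=
  (1 - z ^ 2) * u z + z ^ 2 * conj (u (1 / conj z)) * B a b z

end JacobiJost

/-! Write C_n, G_n for the Geronimo–Case pair, β_n for `beta`, and L = lim G_n = 1 + ∑ β_n C_n. The
Jost function is L / ∏ a_n. Parameters decaying like q^n, with q as close to R⁻² as needed, give
|C_n| ≤ M w^n for |z|² ≤ w, w > 1, qw < 1 (`exists_bound`), so L and B are analytic for |z| < R.
Stripping leading parameters turns L into a Jost solution, and a Wronskian argument makes it unique.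

For |z| > 1, C_n(z)/z^{2n} = C_n(1/z) tends to X(z) = L(1/z)/(1 - z⁻²), with error O(t^n) for t < 1
slightly above max(q, |z|⁻²). Splitting C_n = z^{2n} X + remainder and using B = 1 + ∑ β_n z^{2n}
gives L - X B = 1 - X + ∑ β_n · remainder (`Decay.gcLim_eq`). As (1 - z²) X = -z² L(1/z), the left
side times (1 - z²)/∏ a_n is the combination. The terms on the right are O((q t |z|²)^n), and a
suitable t exists as soon as q|z| < 1, that is, up to |z| < R².

For optimality take a_n = 1, b_n = -R^{-2n}. At real x > 1 every term of the remainder series is at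
most a negative multiple of (x/R²)^{2n}, so the sum tends to -∞ as x increases to R². -/

namespace JacobiJost

/-! ### The Geronimo–Case recursion and decay of the coefficients -/

/-- The coefficient `(1 - a_{n+1}²) z² - b_{n+1} z`. -/
noncomputable def beta (a b : ℕ → ℝ) (z : ℂ) (n : ℕ) : ℂ :=
  (1 - (a (n + 1) : ℂ) ^ 2) * z ^ 2 - (b (n + 1) : ℂ) * z

/-- The Geronimo–Case pair: `z^n P_n(z + z⁻¹)` for the monic orthogonal polynomial `P_n`, together
with its companion. -/
noncomputable def gcPair (a b : ℕ → ℝ) (z : ℂ) : ℕ → ℂ × ℂ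
  | 0 => (1, 1)
  | n + 1 => ((z ^ 2 - (b (n + 1) : ℂ) * z) * (gcPair a b z n).1 + (gcPair a b z n).2,
      beta a b z n * (gcPair a b z n).1 + (gcPair a b z n).2)

noncomputable def gcC (a b : ℕ → ℝ) (z : ℂ) (n : ℕ) : ℂ := (gcPair a b z n).1

noncomputable def gcG (a b : ℕ → ℝ) (z : ℂ) (n : ℕ) : ℂ := (gcPair a b z n).2

@[simp] lemma gcC_zero (a b : ℕ → ℝ) (z : ℂ) : gcC a b z 0 = 1 := rfl

@[simp] lemma gcG_zero (a b : ℕ → ℝ) (z : ℂ) : gcG a b z 0 = 1 := rfl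

lemma gcC_succ (a b : ℕ → ℝ) (z : ℂ) (n : ℕ) :
    gcC a b z (n + 1) = (z ^ 2 - (b (n + 1) : ℂ) * z) * gcC a b z n + gcG a b z n := rfl

lemma gcG_succ (a b : ℕ → ℝ) (z : ℂ) (n : ℕ) :
    gcG a b z (n + 1) = beta a b z n * gcC a b z n + gcG a b z n := rfl

/-- The parameters with the first `m` ones removed. -/
def strip (m : ℕ) (a : ℕ → ℝ) (n : ℕ) : ℝ := a (n + m)

/-- Geometric decay of the perturbation. -/
def Decay (a b : ℕ → ℝ) (K q : ℝ) : Prop :=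
  ∀ n : ℕ, |a (n + 1) ^ 2 - 1| + |b (n + 1)| ≤ K * q ^ n

/-- The limit of `gcG`. -/
noncomputable def gcLim (a b : ℕ → ℝ) (z : ℂ) : ℂ := 1 + ∑' n, beta a b z n * gcC a b z n

lemma Decay.stripped {a b : ℕ → ℝ} {K q : ℝ} (h : Decay a b K q) (m : ℕ) :
    Decay (strip m a) (strip m b) (K * q ^ m) q := by
  intro n
  have := h (n + m)
  simp only [strip, show n + 1 + m = n + m + 1 by omega]
  calc _ ≤ _ := this
    _ = _ := by ring

lemma Decay.mono {a b : ℕ → ℝ} {K K' q : ℝ} (h : Decay a b K q) (hK : K ≤ K') (hq : 0 ≤ q) :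
    Decay a b K' q := fun n => (h n).trans (by gcongr)

lemma Decay.nonneg {a b : ℕ → ℝ} {K q : ℝ} (h : Decay a b K q) : 0 ≤ K := by
  have := h 0
  simp only [pow_zero, mul_one] at this
  exact le_trans (by positivity) this

lemma Decay.norm_b_le {a b : ℕ → ℝ} {K q : ℝ} (h : Decay a b K q) (n : ℕ) :
    ‖(b (n + 1) : ℂ)‖ ≤ K * q ^ n := by
  rw [Complex.norm_real, Real.norm_eq_abs]
  linarith [h n, abs_nonneg (a (n + 1) ^ 2 - 1)]

lemma norm_le_of_sq_le {z : ℂ} {w : ℝ} (hw : 1 ≤ w) (hz : ‖z‖ ^ 2 ≤ w) : ‖z‖ ≤ w := by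
  nlinarith [norm_nonneg z]

lemma Decay.norm_beta_le {a b : ℕ → ℝ} {K q : ℝ} (h : Decay a b K q) {z : ℂ} {w : ℝ} (hw : 1 ≤ w)
    (hz : ‖z‖ ^ 2 ≤ w) (n : ℕ) : ‖beta a b z n‖ ≤ K * q ^ n * w := by
  have h1 : ‖(1 - (a (n + 1) : ℂ) ^ 2)‖ = |a (n + 1) ^ 2 - 1| := by
    rw [← Real.norm_eq_abs, ← Complex.norm_real, ← norm_neg]; push_cast; congr 1; ring
  have h2 : ‖(b (n + 1) : ℂ)‖ = |b (n + 1)| := by rw [Complex.norm_real, Real.norm_eq_abs]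
  have hz' := norm_le_of_sq_le hw hz
  calc ‖beta a b z n‖ ≤ |a (n + 1) ^ 2 - 1| * ‖z‖ ^ 2 + |b (n + 1)| * ‖z‖ := by
        refine (norm_sub_le _ _).trans ?_
        rw [norm_mul, norm_mul, norm_pow, h1, h2]
    _ ≤ |a (n + 1) ^ 2 - 1| * w + |b (n + 1)| * w := by gcongr
    _ = (|a (n + 1) ^ 2 - 1| + |b (n + 1)|) * w := by ring
    _ ≤ _ := by gcongr; exact h n

/-! ### Growth of the Geronimo–Case pair -/

/-- With these two different growth rates, one step of the recursion multiplies the constant by at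
most 1 + η_n with η summable. `M` depends on neither w nor the parameters: w = |z|² can then vary
with z, and one constant serves all stripped sequences. -/
lemma exists_bound {K q t : ℝ} (hK : 0 ≤ K) (hq : 0 ≤ q) (hqt : q < t) (ht : t < 1) :
    ∃ M : ℝ, 0 ≤ M ∧ ∀ (a b : ℕ → ℝ), Decay a b K q → ∀ (z : ℂ) (w : ℝ), ‖z‖ ^ 2 ≤ w →
      1 ≤ w * t → ∀ n, ‖gcC a b z n‖ ≤ M * w ^ n ∧ ‖gcG a b z n‖ ≤ M * (w * t) ^ n := by
  have ht0 : 0 < t := hq.trans_lt hqt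
  -- The three terms pay for b_{n+1} z C_n in the C-step, β_n C_n in the G-step, and G_n in the
  -- C-step.
  set η : ℕ → ℝ := fun n => K * q ^ n + K / t * (q / t) ^ n + t ^ n with hη
  have hη0 : ∀ n, 0 ≤ η n := fun n => by positivity
  have hηs : Summable η := by
    refine ((Summable.mul_left _ ?_).add (Summable.mul_left _ ?_)).add ?_
    · exact summable_geometric_of_lt_one hq (hqt.trans ht)
    · exact summable_geometric_of_lt_one (by positivity) ((div_lt_one ht0).2 hqt)
    · exact summable_geometric_of_lt_one ht0.le ht
  set H : ℕ → ℝ := fun n => ∏ i ∈ Finset.range n, (1 + η i) with hH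
  have hHle : ∀ n, H n ≤ Real.exp (∑' i, η i) := by
    intro n
    calc H n ≤ ∏ i ∈ Finset.range n, Real.exp (η i) :=
          Finset.prod_le_prod (fun i _ => by linarith [hη0 i])
            (fun i _ => by linarith [Real.add_one_le_exp (η i)])
      _ = Real.exp (∑ i ∈ Finset.range n, η i) := (Real.exp_sum _ _).symm
      _ ≤ _ := Real.exp_le_exp.2 (hηs.sum_le_tsum _ fun i _ => hη0 i)
  refine ⟨Real.exp (∑' i, η i), (Real.exp_pos _).le, ?_⟩
  intro a b hd z w hz hwt n
  have hw0 : 0 ≤ w := (by positivity : (0 : ℝ) ≤ ‖z‖ ^ 2).trans hz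
  have hw : 1 ≤ w := by nlinarith
  have key : ∀ n, ‖gcC a b z n‖ ≤ H n * w ^ n ∧ ‖gcG a b z n‖ ≤ H n * (w * t) ^ n := by
    intro n
    induction n with
    | zero => simp [hH]
    | succ n ih =>
      obtain ⟨ihC, ihG⟩ := ih
      have hHn : 0 ≤ H n := Finset.prod_nonneg fun i _ => by linarith [hη0 i]
      have hHs : H (n + 1) = H n * (1 + η n) := Finset.prod_range_succ _ _
      have hqn : 0 ≤ K * q ^ n := by positivity
      constructor
      · rw [gcC_succ, hHs]
        have h1 : ‖z ^ 2 - (b (n + 1) : ℂ) * z‖ ≤ w + K * q ^ n * w := by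
          refine (norm_sub_le _ _).trans ?_
          rw [norm_mul, norm_pow]
          gcongr
          · exact hd.norm_b_le n
          · exact norm_le_of_sq_le hw hz
        have h2 : (w * t) ^ n ≤ t ^ n * w ^ (n + 1) := by
          rw [mul_pow, pow_succ, mul_comm]
          gcongr
          exact le_mul_of_one_le_right (by positivity) hw
        have h3 : 0 ≤ K / t * (q / t) ^ n := by positivity
        calc _ ≤ (w + K * q ^ n * w) * (H n * w ^ n) + H n * (w * t) ^ n := by
              refine (norm_add_le _ _).trans ?_
              rw [norm_mul]
              gcongr
          _ ≤ (w + K * q ^ n * w) * (H n * w ^ n) + H n * (t ^ n * w ^ (n + 1)) := by gcongr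
          _ = H n * (1 + (K * q ^ n + 0 + t ^ n)) * w ^ (n + 1) := by ring
          _ ≤ _ := by simp only [hη]; gcongr
      · rw [gcG_succ, hHs]
        have h2 : (w * t) ^ n ≤ (w * t) ^ (n + 1) := pow_le_pow_right₀ hwt (Nat.le_succ n)
        have h4 : K * q ^ n * w * w ^ n = K / t * (q / t) ^ n * (w * t) ^ (n + 1) := by
          rw [div_pow, mul_pow, pow_succ t]; field_simp; ring
        calc _ ≤ K * q ^ n * w * (H n * w ^ n) + H n * (w * t) ^ n := by
              refine (norm_add_le _ _).trans ?_
              rw [norm_mul]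
              gcongr
              exact hd.norm_beta_le hw hz n
          _ ≤ K * q ^ n * w * (H n * w ^ n) + H n * (w * t) ^ (n + 1) := by gcongr
          _ = H n * (K * q ^ n * w * w ^ n) + H n * (w * t) ^ (n + 1) := by ring
          _ = H n * (1 + (0 + K / t * (q / t) ^ n + 0)) * (w * t) ^ (n + 1) := by rw [h4]; ring
          _ ≤ _ := by simp only [hη]; gcongr; positivity
  exact ⟨(key n).1.trans (by gcongr; exact hHle n), (key n).2.trans (by gcongr; exact hHle n)⟩

/-- A bound for `gcC` that is uniform for `‖z‖² ≤ w`. -/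
lemma exists_bound_disk {K q w : ℝ} (hK : 0 ≤ K) (hq : 0 ≤ q) (hw : 1 < w) (hqw : q * w < 1) :
    ∃ M : ℝ, 0 ≤ M ∧ ∀ (a b : ℕ → ℝ), Decay a b K q → ∀ z : ℂ, ‖z‖ ^ 2 ≤ w →
      ∀ n, ‖gcC a b z n‖ ≤ M * w ^ n := by
  have hw0 : 0 < w := by linarith
  -- Here w t = 1, the smallest value allowed, and q < t is exactly q w < 1.
  obtain ⟨M, hM, h⟩ := exists_bound (t := w⁻¹) hK hq 
    (by rwa [← one_div, lt_div_iff₀ hw0]) (inv_lt_one_of_one_lt₀ hw)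
  exact ⟨M, hM, fun a b hd z hz n => (h a b hd z w hz (mul_inv_cancel₀ hw0.ne').ge n).1⟩

/-- `K'` is kept apart from `K` because stripping m parameters shrinks it to K q^m while `M` stays
fixed. -/
lemma exists_bound_terms {K q w : ℝ} (hK : 0 ≤ K) (hq : 0 ≤ q) (hw : 1 < w) (hqw : q * w < 1) :
    ∃ M : ℝ, 0 ≤ M ∧ ∀ (a b : ℕ → ℝ) (K' : ℝ), K' ≤ K → Decay a b K' q → ∀ z : ℂ, ‖z‖ ^ 2 ≤ w →
      ∀ n, ‖beta a b z n * gcC a b z n‖ ≤ K' * M * (q * w) ^ n := by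
  obtain ⟨M, hM, h⟩ := exists_bound_disk hK hq hw hqw
  refine ⟨w * M, by positivity, fun a b K' hK' hd z hz n => ?_⟩
  have := hd.nonneg
  rw [norm_mul]
  calc _ ≤ (K' * q ^ n * w) * (M * w ^ n) := by
        gcongr
        · exact hd.norm_beta_le hw.le hz n
        · exact h a b (hd.mono hK' hq) z hz n
    _ = _ := by rw [mul_pow]; ring

lemma gcG_eq_sum (a b : ℕ → ℝ) (z : ℂ) (n : ℕ) :
    gcG a b z n = 1 + ∑ k ∈ Finset.range n, beta a b z k * gcC a b z k := by
  induction n with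
  | zero => simp
  | succ n ih => rw [gcG_succ, Finset.sum_range_succ, ih]; ring

/-! ### Convergence and analyticity in a disk -/

section Disk

variable {a b : ℕ → ℝ} {K q w : ℝ}

lemma Decay.summable_terms (hd : Decay a b K q) (hq : 0 ≤ q) (hw : 1 < w) (hqw : q * w < 1)
    {z : ℂ} (hz : ‖z‖ ^ 2 ≤ w) : Summable fun n => beta a b z n * gcC a b z n := by
  obtain ⟨M, hM, h⟩ := exists_bound_terms hd.nonneg hq hw hqw
  exact Summable.of_norm_bounded ((summable_geometric_of_lt_one (by positivity) hqw).mul_left _)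
    (h a b K le_rfl hd z hz)

lemma Decay.tendsto_gcG (hd : Decay a b K q) (hq : 0 ≤ q) (hw : 1 < w) (hqw : q * w < 1)
    {z : ℂ} (hz : ‖z‖ ^ 2 ≤ w) : Tendsto (gcG a b z) atTop (𝓝 (gcLim a b z)) := by
  have := (hd.summable_terms hq hw hqw hz).hasSum.tendsto_sum_nat.const_add 1
  exact this.congr fun n => (gcG_eq_sum a b z n).symm

lemma differentiable_gcC (a b : ℕ → ℝ) (n : ℕ) :
    Differentiable ℂ (fun z => gcC a b z n) ∧ Differentiable ℂ (fun z => gcG a b z n) := by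
  induction n with
  | zero => simp
  | succ n ih =>
    obtain ⟨h1, h2⟩ := ih
    simp only [gcC_succ, gcG_succ, beta]
    constructor <;> fun_prop

lemma differentiable_beta (a b : ℕ → ℝ) (n : ℕ) : Differentiable ℂ (fun z => beta a b z n) := by
  unfold beta; fun_prop

lemma isOpen_normSq_lt (w : ℝ) : IsOpen {z : ℂ | ‖z‖ ^ 2 < w} :=
  isOpen_lt (by fun_prop) continuous_const

lemma Decay.differentiableOn_gcLim (hd : Decay a b K q) (hq : 0 ≤ q) (hw : 1 < w)
    (hqw : q * w < 1) : DifferentiableOn ℂ (gcLim a b) {z | ‖z‖ ^ 2 < w} := by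
  obtain ⟨M, hM, h⟩ := exists_bound_terms hd.nonneg hq hw hqw
  refine DifferentiableOn.const_add 1 (Complex.differentiableOn_tsum_of_summable_norm
    (u := fun n => K * M * (q * w) ^ n)
    ((summable_geometric_of_lt_one (by positivity) hqw).mul_left _) (fun n => ?_)
    (isOpen_normSq_lt w) (fun n z hz => h a b K le_rfl hd z (le_of_lt hz) n))
  exact ((differentiable_beta a b n).mul (differentiable_gcC a b n).1).differentiableOn

/-- Thus B is the series for `gcLim` with C_n replaced by z^{2n}. -/
lemma bTerm_eq (a b : ℕ → ℝ) (z : ℂ) (n : ℕ) : bTerm a b z n = -(beta a b z n * z ^ (2 * n)) := by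
  simp only [bTerm, beta]; ring

lemma Decay.norm_bTerm_le (hd : Decay a b K q) (hq : 0 ≤ q) (hw : 1 < w) {z : ℂ}
    (hz : ‖z‖ ^ 2 ≤ w) (n : ℕ) : ‖bTerm a b z n‖ ≤ K * w * (q * w) ^ n := by
  have := hd.nonneg
  rw [bTerm_eq, norm_neg, norm_mul, norm_pow, pow_mul]
  calc _ ≤ (K * q ^ n * w) * w ^ n := by
        gcongr
        exact hd.norm_beta_le hw.le hz n
    _ = _ := by rw [mul_pow]; ring

lemma Decay.summable_bTerm (hd : Decay a b K q) (hq : 0 ≤ q) (hw : 1 < w) (hqw : q * w < 1)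
    {z : ℂ} (hz : ‖z‖ ^ 2 ≤ w) : Summable (bTerm a b z) :=
  Summable.of_norm_bounded ((summable_geometric_of_lt_one (by positivity) hqw).mul_left _)
    (hd.norm_bTerm_le hq hw hz)

lemma Decay.differentiableOn_B (hd : Decay a b K q) (hq : 0 ≤ q) (hw : 1 < w)
    (hqw : q * w < 1) : DifferentiableOn ℂ (B a b) {z | ‖z‖ ^ 2 < w} := by
  refine DifferentiableOn.const_sub (Complex.differentiableOn_tsum_of_summable_norm
    (u := fun n => K * w * (q * w) ^ n)
    ((summable_geometric_of_lt_one (by positivity) hqw).mul_left _) (fun n => ?_)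
    (isOpen_normSq_lt w) (fun n z hz => hd.norm_bTerm_le hq hw (le_of_lt hz) n)) 1
  unfold bTerm
  fun_prop

lemma Decay.tendsto_gcLim_strip (hd : Decay a b K q) (hq : 0 ≤ q) (hq1 : q < 1)
    (hw : 1 < w) (hqw : q * w < 1) {z : ℂ} (hz : ‖z‖ ^ 2 ≤ w) :
    Tendsto (fun m => gcLim (strip m a) (strip m b) z) atTop (𝓝 1) := by
  have hK := hd.nonneg
  obtain ⟨M, hM, h⟩ := exists_bound_terms hK hq hw hqw
  have hs := hasSum_geometric_of_lt_one (by positivity) hqw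
  rw [tendsto_iff_norm_sub_tendsto_zero]
  have hle : ∀ m, ‖gcLim (strip m a) (strip m b) z - 1‖ ≤ K * q ^ m * M * (1 - q * w)⁻¹ := by
    intro m
    rw [gcLim, add_sub_cancel_left]
    exact tsum_of_norm_bounded (hs.mul_left _)
      (h _ _ _ (mul_le_of_le_one_right hK (pow_le_one₀ hq hq1.le)) (hd.stripped m) z hz)
  refine squeeze_zero (fun m => norm_nonneg _) hle ?_
  have := (((tendsto_pow_atTop_nhds_zero_of_lt_one hq hq1).const_mul K).mul_const M).mul_const
    (1 - q * w)⁻¹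
  simpa using this

end Disk

/-! ### Stripping, inversion and conjugation -/

/-- Removing the first parameter. -/
lemma gcPair_strip (a b : ℕ → ℝ) (z : ℂ) (n : ℕ) :
    gcC a b z (n + 2) = (z ^ 2 + 1 - b 1 * z) * gcC (strip 1 a) (strip 1 b) z (n + 1)
        - a 1 ^ 2 * z ^ 2 * gcC (strip 2 a) (strip 2 b) z n ∧
    gcG a b z (n + 2) = (z ^ 2 + 1 - b 1 * z) * gcG (strip 1 a) (strip 1 b) z (n + 1)
        - a 1 ^ 2 * z ^ 2 * gcG (strip 2 a) (strip 2 b) z n := by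
  induction n with
  | zero =>
    simp only [gcC_succ, gcG_succ, beta, strip, gcC_zero, gcG_zero]
    constructor <;> ring
  | succ n ih =>
    obtain ⟨h1, h2⟩ := ih
    rw [gcC_succ a b z (n + 2), gcG_succ a b z (n + 2), h1, h2,
      gcC_succ (strip 1 a) _ z (n + 1), gcG_succ (strip 1 a) _ z (n + 1),
      gcC_succ (strip 2 a) _ z n, gcG_succ (strip 2 a) _ z n]
    simp only [beta, strip]
    constructor <;> ring

/-- `z⁻²ⁿ C_n(z) = C_n(1/z)`. -/
lemma gcC_inv (a b : ℕ → ℝ) {z : ℂ} (hz : z ≠ 0) (n : ℕ) :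
    gcC a b z⁻¹ n = gcC a b z n / z ^ (2 * n) := by
  -- Eliminating G leaves a three-term recurrence; after division by z^{2n} it is symmetric under z
  -- ↦ z⁻¹.
  have h3 : ∀ (z : ℂ) n, gcC a b z (n + 2) = (z ^ 2 + 1 - b (n + 2) * z) * gcC a b z (n + 1)
      - a (n + 1) ^ 2 * z ^ 2 * gcC a b z n := by
    intro z n
    rw [gcC_succ, gcG_succ, gcC_succ, beta]; ring
  have : ∀ n, gcC a b z⁻¹ n = gcC a b z n / z ^ (2 * n) ∧
      gcC a b z⁻¹ (n + 1) = gcC a b z (n + 1) / z ^ (2 * (n + 1)) := by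
    intro n
    induction n with
    | zero =>
      simp only [gcC_succ, gcC_zero, gcG_zero]
      constructor
      · simp
      · field_simp
        ring
    | succ n ih =>
      refine ⟨ih.2, ?_⟩
      rw [h3, h3, ih.1, ih.2]
      field_simp
      ring
  exact (this n).1

lemma gcPair_conj (a b : ℕ → ℝ) (z : ℂ) (n : ℕ) :
    gcC a b (conj z) n = conj (gcC a b z n) ∧ gcG a b (conj z) n = conj (gcG a b z n) := by
  induction n with
  | zero => simp
  | succ n ih => simp [gcC_succ, gcG_succ, beta, ih.1, ih.2]

lemma gcLim_conj (a b : ℕ → ℝ) (z : ℂ) : gcLim a b (conj z) = conj (gcLim a b z) := by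
  simp only [gcLim, map_add, map_one, Complex.conj_tsum, map_mul, (gcPair_conj a b z _).1]
  simp [beta]

/-! ### From the limsup to geometric decay -/

/-- Used with x = max 1 ‖z‖² for |z| < R and with x = ‖z‖ for 1 < |z| < R². -/
lemma exists_decay {a b : ℕ → ℝ} {R : ℝ≥0∞} (h : HasDecayRate a b R) (hR : R⁻¹ < 1) {x : ℝ}
    (hx0 : 0 < x) (hx : ENNReal.ofReal x < R ^ 2) :
    ∃ K q : ℝ, 0 < q ∧ q < 1 ∧ q * x < 1 ∧ Decay a b K q := by
  have hy : ENNReal.ofReal (√x) < R := by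
    by_contra! hle
    have h2 : R ^ 2 ≤ ENNReal.ofReal (√x) ^ 2 := by gcongr
    rw [← ENNReal.ofReal_pow (Real.sqrt_nonneg x), Real.sq_sqrt hx0.le] at h2
    exact absurd hx h2.not_gt
  have hy0 : 0 < √x := Real.sqrt_pos.2 hx0
  obtain ⟨σ, hσ1, hσ2⟩ := exists_between (lt_min hR (ENNReal.inv_lt_inv.2 hy))
  rw [lt_min_iff] at hσ2
  have hσt : σ ≠ ⊤ := (hσ2.1.trans ENNReal.one_lt_top).ne
  set s := σ.toReal with hs
  have hσs : σ = ENNReal.ofReal s := (ENNReal.ofReal_toReal hσt).symm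
  have hs0 : 0 < s := ENNReal.toReal_pos (bot_le.trans_lt hσ1).ne' hσt
  have hs1 : s < 1 := by
    have := hσ2.1
    rwa [hσs, ENNReal.ofReal_lt_one] at this
  have hsy : s < (√x)⁻¹ := by
    have := hσ2.2
    rwa [hσs, ← ENNReal.ofReal_inv_of_pos hy0, ENNReal.ofReal_lt_ofReal_iff (by positivity)] at this
  have hsx : s ^ 2 * x < 1 := by
    have h1 : s * √x < 1 := by rwa [← one_div, lt_div_iff₀ hy0] at hsy
    calc s ^ 2 * x = (s * √x) ^ 2 := by rw [mul_pow, Real.sq_sqrt hx0.le]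
      _ < 1 := pow_lt_one₀ (by positivity) h1 two_ne_zero
  have hev : ∀ᶠ n : ℕ in atTop, (|a n ^ 2 - 1| + |b n|) ≤ s ^ (2 * n) := by
    have h1 := eventually_lt_of_limsup_lt (lt_of_eq_of_lt h hσ1)
    filter_upwards [h1, eventually_gt_atTop 0] with n hn hn0
    rw [hσs, ENNReal.ofReal_lt_ofReal_iff hs0] at hn
    have hX : 0 ≤ |a n ^ 2 - 1| + |b n| := by positivity
    have hn0' : (n : ℝ) ≠ 0 := by positivity
    calc |a n ^ 2 - 1| + |b n|
        = ((|a n ^ 2 - 1| + |b n|) ^ (1 / (2 * (n : ℝ)))) ^ (2 * n) := by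
          rw [← Real.rpow_natCast _ (2 * n), ← Real.rpow_mul hX]
          push_cast
          rw [one_div_mul_cancel (by positivity), Real.rpow_one]
      _ ≤ s ^ (2 * n) := by gcongr
  -- The finitely many exceptional indices are absorbed into the constant.
  have hbdd : BddAbove (Set.range fun n : ℕ => (|a n ^ 2 - 1| + |b n|) / s ^ (2 * n)) := by
    refine IsBoundedUnder.bddAbove_range ⟨1, ?_⟩
    rw [eventually_map]
    filter_upwards [hev] with n hn
    exact (div_le_one (by positivity)).2 hn
  obtain ⟨K, hK⟩ := hbdd
  refine ⟨K * s ^ 2, s ^ 2, by positivity, pow_lt_one₀ hs0.le hs1 two_ne_zero, hsx, fun n => ?_⟩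
  have := hK ⟨n + 1, rfl⟩
  simp only at this
  rw [div_le_iff₀ (by positivity)] at this
  calc _ ≤ _ := this
    _ = _ := by ring

lemma enorm_eq (z : ℂ) : ‖z‖ₑ = ENNReal.ofReal ‖z‖ := (ofReal_norm z).symm

lemma one_lt_radius {R : ℝ≥0∞} (hR : R⁻¹ < 1) : 1 < R := ENNReal.inv_lt_one.1 hR

lemma enorm_lt_radius {R : ℝ≥0∞} (hR : R⁻¹ < 1) {z : ℂ} (hz : ‖z‖ < 1) : ‖z‖ₑ < R := by
  refine lt_trans ?_ (one_lt_radius hR)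
  rwa [enorm_eq, ENNReal.ofReal_lt_one]

lemma exists_decay_disk {a b : ℕ → ℝ} {R : ℝ≥0∞} (h : HasDecayRate a b R) (hR : R⁻¹ < 1) {z : ℂ}
    (hz : ‖z‖ₑ < R) :
    ∃ K q w : ℝ, 0 < q ∧ q < 1 ∧ 1 < w ∧ q * w < 1 ∧ ‖z‖ ^ 2 < w ∧ Decay a b K q := by
  have h1 : ENNReal.ofReal (max 1 (‖z‖ ^ 2)) < R ^ 2 := by
    rw [ENNReal.ofReal_max, max_lt_iff, ENNReal.ofReal_one,
      ENNReal.ofReal_pow (norm_nonneg z), ← enorm_eq]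
    exact ⟨one_lt_pow₀ (one_lt_radius hR) two_ne_zero, ENNReal.pow_lt_pow_left two_ne_zero hz⟩
  have hx : 0 < max 1 (‖z‖ ^ 2) := by positivity
  obtain ⟨K, q, hq0, hq1, hqx, hd⟩ := exists_decay h hR hx h1
  obtain ⟨w, hw1, hw2⟩ := exists_between ((lt_div_iff₀' hq0).2 hqx)
  rw [max_lt_iff] at hw1
  exact ⟨K, q, w, hq0, hq1, hw1.1, (lt_div_iff₀' hq0).1 hw2, hw1.2, hd⟩

/-! ### The Jost solution: existence and uniqueness -/

/-- The logarithm of the product of the off-diagonal coefficients from index `m` on. -/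
noncomputable def logTail (a : ℕ → ℝ) (m : ℕ) : ℝ := ∑' n, Real.log (offDiag a (n + m))

/-- The Jost function. -/
noncomputable def jostFn (a b : ℕ → ℝ) (z : ℂ) : ℂ := gcLim a b z / Real.exp (logTail a 0)

/-- The Jost solution. -/
noncomputable def jostSol (a b : ℕ → ℝ) (z : ℂ) (m : ℕ) : ℂ :=
  z ^ m * gcLim (strip m a) (strip m b) z / Real.exp (logTail a m)

lemma jostSol_zero (a b : ℕ → ℝ) (z : ℂ) : jostSol a b z 0 = jostFn a b z := by
  simp only [jostSol, jostFn, pow_zero, one_mul]; rfl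

lemma offDiag_pos {a : ℕ → ℝ} (ha : ∀ n : ℕ, 1 ≤ n → 0 < a n) (n : ℕ) : 0 < offDiag a n := by
  unfold offDiag
  split_ifs with h
  · exact one_pos
  · exact ha n (Nat.one_le_iff_ne_zero.2 h)

lemma Decay.summable_log {a b : ℕ → ℝ} {K q : ℝ} (hd : Decay a b K q) (hq : 0 ≤ q) (hq1 : q < 1) :
    Summable fun n => Real.log (offDiag a n) := by
  have h1 : Summable fun n => a (n + 1) ^ 2 - 1 := by
    refine Summable.of_norm_bounded ((summable_geometric_of_lt_one hq hq1).mul_left K) fun n => ?_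
    rw [Real.norm_eq_abs]
    linarith [hd n, abs_nonneg (b (n + 1))]
  have h2 := (Real.summable_log_one_add_of_summable h1).mul_left (1 / 2)
  rw [← summable_nat_add_iff 1]
  refine h2.congr fun n => ?_
  rw [add_sub_cancel, Real.log_pow, offDiag, if_neg (Nat.succ_ne_zero n)]
  push_cast
  ring

lemma exp_logTail {a : ℕ → ℝ} (ha : ∀ n : ℕ, 1 ≤ n → 0 < a n)
    (hs : Summable fun n => Real.log (offDiag a n)) (m : ℕ) :
    Real.exp (logTail a m) = offDiag a m * Real.exp (logTail a (m + 1)) := by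
  have h1 : logTail a m = Real.log (offDiag a m) + logTail a (m + 1) := by
    rw [logTail, ((summable_nat_add_iff m).2 hs).tsum_eq_zero_add, zero_add, logTail]
    congr 2
    ext n
    rw [show n + 1 + m = n + (m + 1) by omega]
  rw [h1, Real.exp_add, Real.exp_log (offDiag_pos ha m)]

section Solution

variable {a b : ℕ → ℝ} {K q w : ℝ}

/-- This is the limit n → ∞ of `gcPair_strip` for the m-stripped parameters; up to normalization it
is the Jacobi equation. -/
lemma Decay.gcLim_recurrence (hd : Decay a b K q) (hq : 0 ≤ q) (hw : 1 < w) (hqw : q * w < 1)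
    {z : ℂ} (hz : ‖z‖ ^ 2 ≤ w) (m : ℕ) :
    gcLim (strip m a) (strip m b) z
      = (z ^ 2 + 1 - b (m + 1) * z) * gcLim (strip (m + 1) a) (strip (m + 1) b) z
        - a (m + 1) ^ 2 * z ^ 2 * gcLim (strip (m + 2) a) (strip (m + 2) b) z := by
  have hst : ∀ (c : ℕ → ℝ) (k : ℕ), strip k (strip m c) = strip (m + k) c := by
    intro c k
    ext n
    simp only [strip]
    congr 1
    omega
  have hlim : ∀ k, Tendsto (gcG (strip k a) (strip k b) z) atTop
      (𝓝 (gcLim (strip k a) (strip k b) z)) := fun k =>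
    (hd.stripped k).tendsto_gcG hq hw hqw hz
  refine tendsto_nhds_unique ((tendsto_add_atTop_iff_nat 2).2 (hlim m)) ?_
  have h1 := (((tendsto_add_atTop_iff_nat 1).2 (hlim (m + 1))).const_mul
    (z ^ 2 + 1 - b (m + 1) * z)).sub ((hlim (m + 2)).const_mul ((a (m + 1) : ℂ) ^ 2 * z ^ 2))
  refine h1.congr fun n => ?_
  rw [(gcPair_strip (strip m a) (strip m b) z n).2, hst, hst, hst, hst]
  simp only [strip, add_comm 1 m]

lemma Decay.isJostSolution (hd : Decay a b K q) (ha : ∀ n : ℕ, 1 ≤ n → 0 < a n) (hq : 0 ≤ q)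
    (hq1 : q < 1) (hw : 1 < w) (hqw : q * w < 1) {z : ℂ} (hz0 : z ≠ 0) (hz : ‖z‖ ^ 2 ≤ w) :
    IsJostSolution a b z (jostSol a b z) := by
  have hs := hd.summable_log hq hq1
  constructor
  · intro n
    have h1 := exp_logTail ha hs n
    have h2 := exp_logTail ha hs (n + 1)
    have hp1 : (offDiag a n : ℂ) ≠ 0 := by exact_mod_cast (offDiag_pos ha n).ne'
    have hp2 : (offDiag a (n + 1) : ℂ) ≠ 0 := by exact_mod_cast (offDiag_pos ha (n + 1)).ne'
    have hp3 : (Real.exp (logTail a (n + 2)) : ℂ) ≠ 0 := by exact_mod_cast (Real.exp_pos _).ne'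
    have ha1 : (a (n + 1) : ℂ) = offDiag a (n + 1) := by
      rw [offDiag, if_neg (Nat.succ_ne_zero n)]
    simp only [jostSol]
    rw [hd.gcLim_recurrence hq hw hqw hz n, h1, h2, ha1]
    push_cast only [Complex.ofReal_mul]
    field_simp
    ring
  · have h1 : Tendsto (logTail a) atTop (𝓝 0) :=
      tendsto_sum_nat_add fun n => Real.log (offDiag a n)
    have h2 : Tendsto (fun m => (Real.exp (logTail a m) : ℂ)) atTop (𝓝 1) := by
      have := (Complex.continuous_ofReal.tendsto _).comp ((Real.continuous_exp.tendsto 0).comp h1)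
      simpa [Function.comp_def] using this
    have h3 := (hd.tendsto_gcLim_strip hq hq1 hw hqw hz).div h2 one_ne_zero
    rw [div_one] at h3
    refine h3.congr fun m => ?_
    simp only [jostSol, Pi.div_apply]
    field_simp

lemma IsJostSolution.wronskian {z : ℂ} {ψ χ : ℕ → ℂ} (hψ : IsJostSolution a b z ψ)
    (hχ : IsJostSolution a b z χ) (n : ℕ) :
    (offDiag a (n + 1) : ℂ) * (ψ (n + 1) * χ (n + 2) - ψ (n + 2) * χ (n + 1))
      = offDiag a n * (ψ n * χ (n + 1) - ψ (n + 1) * χ n) := by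
  linear_combination ψ (n + 1) * hχ.1 n - χ (n + 1) * hψ.1 n

/-- The Wronskian is constant, yet of size z^{2n+1}, hence zero. So χ/ψ is eventually constant,
equal to its limit 1, and the recurrence run downwards carries equality to index 0. -/
lemma IsJostSolution.unique (hd : Decay a b K q) (ha : ∀ n : ℕ, 1 ≤ n → 0 < a n) (hq : 0 ≤ q)
    (hq1 : q < 1) {z : ℂ} (hz0 : z ≠ 0) (hz : ‖z‖ < 1) {ψ χ : ℕ → ℂ}
    (hψ : IsJostSolution a b z ψ) (hχ : IsJostSolution a b z χ) : ψ = χ := by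
  have hoff : ∀ n, (offDiag a n : ℂ) ≠ 0 := fun n => by exact_mod_cast (offDiag_pos ha n).ne'
  set W : ℕ → ℂ := fun n => offDiag a n * (ψ n * χ (n + 1) - ψ (n + 1) * χ n) with hW
  have hWc : ∀ n, W n = W 0 := by
    intro n
    induction n with
    | zero => rfl
    | succ n ih => rw [← ih]; exact hψ.wronskian hχ n
  have hoff1 : Tendsto (fun n => (offDiag a n : ℂ)) atTop (𝓝 1) := by
    have h1 := (hd.summable_log hq hq1).tendsto_atTop_zero
    have := (Complex.continuous_ofReal.tendsto _).comp ((Real.continuous_exp.tendsto 0).comp h1)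
    simp only [Function.comp_def, Real.exp_zero, Complex.ofReal_one] at this
    refine this.congr fun n => ?_
    rw [Real.exp_log (offDiag_pos ha n)]
  have hpow : Tendsto (fun n : ℕ => z ^ (2 * n + 1)) atTop (𝓝 0) :=
    (tendsto_pow_atTop_nhds_zero_of_norm_lt_one hz).comp
      (tendsto_atTop_mono (fun n => by simp only [id]; omega) tendsto_id)
  have hψ1 := (tendsto_add_atTop_iff_nat 1).2 hψ.2
  have hχ1 := (tendsto_add_atTop_iff_nat 1).2 hχ.2
  have hW0 : Tendsto W atTop (𝓝 0) := by
    have := (hoff1.mul hpow).mul ((hψ.2.mul hχ1).sub (hψ1.mul hχ.2))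
    simp only [mul_zero, zero_mul] at this
    refine this.congr fun n => ?_
    simp only [hW]
    have e : z ^ (2 * n + 1) = z ^ n * z ^ (n + 1) := by ring
    rw [e]
    field_simp
  have hW00 : W 0 = 0 := tendsto_nhds_unique (tendsto_const_nhds.congr fun n => (hWc n).symm) hW0
  have hcross : ∀ n, ψ n * χ (n + 1) = ψ (n + 1) * χ n := fun n => by
    have h1 := hWc n
    rw [hW00] at h1
    exact sub_eq_zero.1 ((mul_eq_zero.1 h1).resolve_left (hoff n))
  have hne : ∀ᶠ n in atTop, ψ n ≠ 0 := by
    filter_upwards [hψ.2.eventually_ne one_ne_zero] with n hn h0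
    exact hn (by rw [h0, zero_div])
  obtain ⟨N, hN⟩ := eventually_atTop.1 hne
  have hratio : ∀ n, N ≤ n → χ n / ψ n = χ N / ψ N := by
    intro n hn
    induction n, hn using Nat.le_induction with
    | base => rfl
    | succ n hn ih =>
      rw [← ih, div_eq_div_iff (hN _ (by omega)) (hN _ hn)]
      linear_combination hcross n
  have hlim : Tendsto (fun n => χ n / ψ n) atTop (𝓝 1) := by
    have := hχ.2.div hψ.2 one_ne_zero
    rw [div_one] at this
    refine this.congr fun n => ?_
    simp only [Pi.div_apply]
    rw [div_div_div_cancel_right₀ (pow_ne_zero n hz0)]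
  have hc : χ N / ψ N = 1 := by
    refine tendsto_nhds_unique (tendsto_const_nhds.congr' ?_) hlim
    filter_upwards [eventually_ge_atTop N] with n hn
    exact (hratio n hn).symm
  have htail : ∀ n, N ≤ n → ψ n = χ n := fun n hn => by
    have := hratio n hn
    rw [hc, div_eq_one_iff_eq (hN n hn)] at this
    exact this.symm
  have hdown : ∀ n, ψ (n + 1) = χ (n + 1) → ψ (n + 2) = χ (n + 2) → ψ n = χ n := by
    intro n h1 h2
    refine mul_left_cancel₀ (hoff n) ?_
    have e1 := hψ.1 n
    rw [h1, h2] at e1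
    linear_combination e1 - hχ.1 n
  have hpair : ∀ k n, N ≤ n + k → ψ n = χ n ∧ ψ (n + 1) = χ (n + 1) := by
    intro k
    induction k with
    | zero => exact fun n hn => ⟨htail n hn, htail (n + 1) (by omega)⟩
    | succ k ih =>
      intro n hn
      have := ih (n + 1) (by omega)
      exact ⟨hdown n this.1 this.2, this.1⟩
  ext n
  exact (hpair N n (by omega)).1

end Solution

/-! ### Analyticity up to the radius R -/

section Radius

variable {a b : ℕ → ℝ} {R : ℝ≥0∞}

lemma differentiableAt_gcLim (h : HasDecayRate a b R) (hR : R⁻¹ < 1) {z : ℂ} (hz : ‖z‖ₑ < R) :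
    DifferentiableAt ℂ (gcLim a b) z := by
  obtain ⟨K, q, w, hq, hq1, hw, hqw, hzw, hd⟩ := exists_decay_disk h hR hz
  exact (hd.differentiableOn_gcLim hq.le hw hqw).differentiableAt
    ((isOpen_normSq_lt w).mem_nhds hzw)

lemma differentiableAt_B (h : HasDecayRate a b R) (hR : R⁻¹ < 1) {z : ℂ} (hz : ‖z‖ₑ < R) :
    DifferentiableAt ℂ (B a b) z := by
  obtain ⟨K, q, w, hq, hq1, hw, hqw, hzw, hd⟩ := exists_decay_disk h hR hz
  exact (hd.differentiableOn_B hq.le hw hqw).differentiableAt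
    ((isOpen_normSq_lt w).mem_nhds hzw)

lemma summable_bTerm (h : HasDecayRate a b R) (hR : R⁻¹ < 1) {z : ℂ} (hz : ‖z‖ₑ < R) :
    Summable (bTerm a b z) := by
  obtain ⟨K, q, w, hq, hq1, hw, hqw, hzw, hd⟩ := exists_decay_disk h hR hz
  exact hd.summable_bTerm hq.le hw hqw hzw.le

lemma differentiableAt_jostFn (h : HasDecayRate a b R) (hR : R⁻¹ < 1) {z : ℂ} (hz : ‖z‖ₑ < R) :
    DifferentiableAt ℂ (jostFn a b) z :=
  (differentiableAt_gcLim h hR hz).div_const _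

lemma analyticOnNhd_jostFn (h : HasDecayRate a b R) (hR : R⁻¹ < 1) :
    AnalyticOnNhd ℂ (jostFn a b) {z : ℂ | ‖z‖ₑ < R} :=
  DifferentiableOn.analyticOnNhd
    (fun _ hz => (differentiableAt_jostFn h hR hz).differentiableWithinAt)
    (isOpen_lt continuous_enorm continuous_const)

lemma isJostFunction_jostFn (ha : ∀ n : ℕ, 1 ≤ n → 0 < a n) (h : HasDecayRate a b R)
    (hR : R⁻¹ < 1) : IsJostFunction a b (jostFn a b) := by
  constructor
  · refine (analyticOnNhd_jostFn h hR).mono fun z hz => ?_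
    exact enorm_lt_radius hR (by simpa using hz)
  · intro z hz0 hz1
    obtain ⟨K, q, w, hq, hq1, hw, hqw, hzw, hd⟩ := exists_decay_disk h hR (enorm_lt_radius hR hz1)
    have hsol := hd.isJostSolution ha hq.le hq1 hw hqw hz0 hzw.le
    have huniq : ∀ ψ, IsJostSolution a b z ψ → ψ = jostSol a b z := fun ψ hψ =>
      IsJostSolution.unique hd ha hq.le hq1 hz0 hz1 hψ hsol
    exact ⟨⟨_, hsol, huniq⟩, fun ψ hψ => by rw [huniq ψ hψ, jostSol_zero]⟩

/-- The parameters are real, so both conjugations cancel. -/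
lemma conj_jostFn (a b : ℕ → ℝ) (z : ℂ) : conj (jostFn a b (1 / conj z)) = jostFn a b z⁻¹ := by
  have : 1 / conj z = conj z⁻¹ := by rw [map_inv₀, one_div]
  rw [this, jostFn, gcLim_conj, map_div₀, Complex.conj_conj, Complex.conj_ofReal, jostFn]

lemma combination_jostFn (a b : ℕ → ℝ) (z : ℂ) : combination a b (jostFn a b) z =
    (1 - z ^ 2) * jostFn a b z + z ^ 2 * jostFn a b z⁻¹ * B a b z := by
  rw [combination, conj_jostFn]

lemma isOpen_annulus (r s : ℝ≥0∞) : IsOpen (annulus r s) :=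
  (isOpen_lt continuous_const continuous_enorm).inter (isOpen_lt continuous_enorm continuous_const)

lemma analyticOnNhd_combination (h : HasDecayRate a b R) (hR : R⁻¹ < 1) :
    AnalyticOnNhd ℂ (combination a b (jostFn a b)) (annulus R⁻¹ R) := by
  refine DifferentiableOn.analyticOnNhd (fun z hz => ?_) (isOpen_annulus _ _)
  have hz0 : z ≠ 0 := by
    rintro rfl
    simpa using hz.1
  have hinv : ‖z⁻¹‖ₑ < R := by
    rw [enorm_inv hz0]
    exact ENNReal.inv_lt_iff_inv_lt.1 hz.1
  have h1 := differentiableAt_jostFn h hR hz.2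
  have h2 : DifferentiableAt ℂ (fun z => jostFn a b z⁻¹) z :=
    (differentiableAt_jostFn h hR hinv).comp z (differentiableAt_inv hz0)
  have h3 := differentiableAt_B h hR hz.2
  have : DifferentiableAt ℂ (combination a b (jostFn a b)) z := by
    rw [funext (combination_jostFn a b)]
    fun_prop
  exact this.differentiableWithinAt

end Radius

/-! ### Continuation across |z| = R -/

/-- The limit of `z⁻²ⁿ C_n(z)` outside the closed unit disk. -/
noncomputable def outerLim (a b : ℕ → ℝ) (z : ℂ) : ℂ := gcLim a b z⁻¹ / (1 - z⁻¹ ^ 2)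

/-- The remainder in `C_n(z) ≈ z²ⁿ X(z)`. -/
noncomputable def outerRem (a b : ℕ → ℝ) (z : ℂ) (n : ℕ) : ℂ :=
  gcC a b z n - z ^ (2 * n) * outerLim a b z

/-- The extension of `gcLim - outerLim * B` across the circle `‖z‖ = R`. -/
noncomputable def outer (a b : ℕ → ℝ) (z : ℂ) : ℂ :=
  1 - outerLim a b z + ∑' n, beta a b z n * outerRem a b z n

section Outer

variable {a b : ℕ → ℝ} {K q t w : ℝ}

/-- The difference is (b_{n+1} z C_n - G_n)/z^{2n+2} up to sign, where b decays like q^n and G_n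
grows only like (|z|² t)^n. -/
lemma Decay.exists_bound_diff (hd : Decay a b K q) (hq : 0 ≤ q) (hqt : q < t) (ht : t < 1) :
    ∃ M : ℝ, 0 ≤ M ∧ ∀ z : ℂ, 1 ≤ ‖z‖ ^ 2 * t → ∀ n,
      dist (gcC a b z n / z ^ (2 * n)) (gcC a b z (n + 1) / z ^ (2 * (n + 1))) ≤ M * t ^ n := by
  have hK := hd.nonneg
  have ht0 : 0 < t := hq.trans_lt hqt
  obtain ⟨M, hM, h⟩ := exists_bound hK hq hqt ht
  refine ⟨M * (1 + K), by positivity, fun z hz n => ?_⟩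
  have hw : 1 ≤ ‖z‖ ^ 2 := by nlinarith [sq_nonneg ‖z‖]
  have hz1 := norm_le_of_sq_le hw le_rfl
  have hz0 : z ≠ 0 := by
    rintro rfl
    norm_num at hw
  obtain ⟨hC, hG⟩ := h a b hd z _ le_rfl hz n
  have e : gcC a b z n / z ^ (2 * n) - gcC a b z (n + 1) / z ^ (2 * (n + 1))
      = -((gcG a b z n - b (n + 1) * z * gcC a b z n) / z ^ (2 * (n + 1))) := by
    rw [gcC_succ]
    field_simp
    ring
  rw [dist_eq_norm, e, norm_neg, norm_div, norm_pow, pow_mul, div_le_iff₀ (by positivity)]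
  set v := ‖z‖ ^ 2 with hv
  have hqn : q ^ n ≤ t ^ n := by gcongr
  calc ‖gcG a b z n - b (n + 1) * z * gcC a b z n‖
      ≤ M * (v * t) ^ n + K * q ^ n * v * (M * v ^ n) := by
        refine (norm_sub_le _ _).trans ?_
        rw [norm_mul, norm_mul]
        gcongr
        exact hd.norm_b_le n
    _ ≤ M * (v * t) ^ n * v + K * t ^ n * v * (M * v ^ n) := by
        have hv0 : 0 ≤ v := by linarith
        refine add_le_add (le_mul_of_one_le_right (by positivity) hw) ?_
        gcongr
    _ = M * (1 + K) * t ^ n * v ^ (n + 1) := by rw [mul_pow]; ring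

lemma Decay.tendsto_outerLim (hd : Decay a b K q) (hq : 0 < q) (hq1 : q < 1) {z : ℂ}
    (hz : 1 < ‖z‖) : Tendsto (fun n => gcC a b z n / z ^ (2 * n)) atTop (𝓝 (outerLim a b z)) := by
  have hz0 : z ≠ 0 := norm_pos_iff.1 (by linarith)
  have hz2 : 1 < ‖z‖ ^ 2 := one_lt_pow₀ hz two_ne_zero
  obtain ⟨t, ht1, ht2⟩ := exists_between (max_lt hq1 (inv_lt_one_of_one_lt₀ hz2))
  rw [max_lt_iff] at ht1
  obtain ⟨M, -, hM⟩ := hd.exists_bound_diff hq.le ht1.1 ht2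
  have hzt : 1 ≤ ‖z‖ ^ 2 * t := by
    have := mul_lt_mul_of_pos_left ht1.2 (by positivity : 0 < ‖z‖ ^ 2)
    rw [mul_inv_cancel₀ (by positivity)] at this
    exact this.le
  obtain ⟨L, hL⟩ := cauchySeq_tendsto_of_complete (cauchySeq_of_le_geometric t M ht2 (hM z hzt))
  have hL' : Tendsto (gcC a b z⁻¹) atTop (𝓝 L) := hL.congr fun n => (gcC_inv a b hz0 n).symm
  have hi : ‖z⁻¹‖ < 1 := by rw [norm_inv]; exact inv_lt_one_of_one_lt₀ hz
  have hi2 : ‖z⁻¹‖ ^ 2 < 1 := pow_lt_one₀ (norm_nonneg _) hi two_ne_zero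
  obtain ⟨w, hw1, hw2⟩ := exists_between (one_lt_inv₀ hq |>.2 hq1)
  have hqw : q * w < 1 := by
    have := mul_lt_mul_of_pos_left hw2 hq
    rwa [mul_inv_cancel₀ hq.ne'] at this
  have hG := hd.tendsto_gcG hq.le hw1 hqw (hi2.le.trans hw1.le)
  have hb : Tendsto (fun n => (b (n + 1) : ℂ)) atTop (𝓝 0) := by
    refine squeeze_zero_norm hd.norm_b_le ?_
    simpa using (tendsto_pow_atTop_nhds_zero_of_lt_one hq.le hq1).const_mul K
  -- The C-recursion at z⁻¹ in the limit, with b_n → 0; solving it for L gives `outerLim`.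
  have hrec : L = (z⁻¹ ^ 2 - 0 * z⁻¹) * L + gcLim a b z⁻¹ := by
    refine tendsto_nhds_unique ((tendsto_add_atTop_iff_nat 1).2 hL') ?_
    exact ((tendsto_const_nhds.sub (hb.mul_const _)).mul hL').add hG
  have hne : 1 - z⁻¹ ^ 2 ≠ 0 := by
    intro h0
    have := congrArg norm (sub_eq_zero.1 h0)
    rw [norm_one, norm_pow] at this
    linarith
  have : outerLim a b z = L := by
    rw [outerLim, div_eq_iff hne]
    linear_combination -hrec
  rwa [this]

/-- The remainder is z^{2n} times the distance of C_n/z^{2n} to its limit, which gains the extra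
factor t^n. -/
lemma Decay.exists_bound_outer_terms (hd : Decay a b K q) (hq : 0 < q) (hqt : q < t) (ht : t < 1) :
    ∃ M : ℝ, 0 ≤ M ∧ ∀ z : ℂ, 1 < ‖z‖ → 1 ≤ ‖z‖ ^ 2 * t → ‖z‖ ^ 2 ≤ w → ∀ n,
      ‖beta a b z n * outerRem a b z n‖ ≤ M * (q * t * w) ^ n := by
  by_cases hw : 1 < w
  · have hK := hd.nonneg
    have ht0 : 0 < t := hq.trans hqt
    have ht1 : 0 < 1 - t := sub_pos.2 ht
    obtain ⟨M, hM, h⟩ := hd.exists_bound_diff hq.le hqt ht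
    refine ⟨K * w * (M / (1 - t)), by positivity, fun z hz hzt hzw n => ?_⟩
    have hz0 : z ≠ 0 := norm_pos_iff.1 (by linarith)
    have h1 := dist_le_of_le_geometric_of_tendsto t M ht (h z hzt)
      (hd.tendsto_outerLim hq (hqt.trans ht) hz) n
    rw [dist_eq_norm] at h1
    have e : outerRem a b z n
        = z ^ (2 * n) * (gcC a b z n / z ^ (2 * n) - outerLim a b z) := by
      rw [outerRem]
      field_simp
    rw [e, norm_mul, norm_mul, norm_pow, pow_mul]
    calc _ ≤ K * q ^ n * w * (w ^ n * (M * t ^ n / (1 - t))) := by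
          gcongr
          exact hd.norm_beta_le hw.le hzw n
      _ = _ := by rw [mul_pow, mul_pow]; ring
  · refine ⟨0, le_rfl, fun z hz _ hzw => ?_⟩
    nlinarith

lemma Decay.differentiableAt_outerLim (hd : Decay a b K q) (hq : 0 < q) (hq1 : q < 1) {z : ℂ}
    (hz : 1 < ‖z‖) : DifferentiableAt ℂ (outerLim a b) z := by
  have hz0 : z ≠ 0 := norm_pos_iff.1 (by linarith)
  have hi : ‖z⁻¹‖ < 1 := by rw [norm_inv]; exact inv_lt_one_of_one_lt₀ hz
  have hi2 : ‖z⁻¹‖ ^ 2 < 1 := pow_lt_one₀ (norm_nonneg _) hi two_ne_zero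
  obtain ⟨w, hw1, hw2⟩ := exists_between (one_lt_inv₀ hq |>.2 hq1)
  have hqw : q * w < 1 := by
    have := mul_lt_mul_of_pos_left hw2 hq
    rwa [mul_inv_cancel₀ hq.ne'] at this
  have hne : 1 - z⁻¹ ^ 2 ≠ 0 := by
    intro h0
    have := congrArg norm (sub_eq_zero.1 h0)
    rw [norm_one, norm_pow] at this
    linarith
  have h1 : DifferentiableAt ℂ (gcLim a b) z⁻¹ :=
    (hd.differentiableOn_gcLim hq.le hw1 hqw).differentiableAt
      ((isOpen_normSq_lt w).mem_nhds (hi2.trans hw1))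
  have h2 : DifferentiableAt ℂ (fun z : ℂ => z⁻¹) z := differentiableAt_inv hz0
  exact (h1.comp z h2).div ((differentiableAt_const 1).sub (h2.pow 2)) hne

/-- This is where R² comes from: the t needed lies between max(q, |z₀|⁻²) and min(1, 1/(q|z₀|²)),
and q < 1/(q|z₀|²) amounts to q|z₀| < 1. -/
lemma Decay.outer_regular (hd : Decay a b K q) (hq : 0 < q) (hq1 : q < 1) {z₀ : ℂ}
    (hz₀ : 1 < ‖z₀‖) (hqz : q * ‖z₀‖ < 1) :
    DifferentiableAt ℂ (outer a b) z₀ ∧ Summable fun n => beta a b z₀ n * outerRem a b z₀ n := by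
  have hv1 : 1 < ‖z₀‖ ^ 2 := one_lt_pow₀ hz₀ two_ne_zero
  have hq2 : q * (q * ‖z₀‖ ^ 2) < 1 := by
    calc q * (q * ‖z₀‖ ^ 2) = (q * ‖z₀‖) ^ 2 := by ring
      _ < 1 := pow_lt_one₀ (by positivity) hqz two_ne_zero
  set v := ‖z₀‖ ^ 2 with hv
  have hv0 : 0 < v := by linarith
  have hlt : max q v⁻¹ < min 1 (1 / (q * v)) := by
    refine max_lt (lt_min hq1 ?_) (lt_min (inv_lt_one_of_one_lt₀ hv1) ?_)
    · rwa [lt_div_iff₀ (by positivity)]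
    · rw [lt_div_iff₀ (by positivity)]
      calc v⁻¹ * (q * v) = q := by field_simp
        _ < 1 := hq1
  obtain ⟨t, ht1, ht2⟩ := exists_between hlt
  rw [max_lt_iff] at ht1
  rw [lt_min_iff] at ht2
  have ht0 : 0 < t := hq.trans ht1.1
  have hvt : 1 < v * t := by
    have := mul_lt_mul_of_pos_left ht1.2 hv0
    rwa [mul_inv_cancel₀ hv0.ne'] at this
  have hqtv : v < 1 / (q * t) := by
    have := (lt_div_iff₀ (by positivity)).1 ht2.2
    rw [lt_div_iff₀ (by positivity)]
    linarith
  obtain ⟨w, hw1, hw2⟩ := exists_between hqtv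
  have hw0 : 0 < w := hv0.trans hw1
  have hqtw : q * t * w < 1 := by rwa [lt_div_iff₀' (by positivity)] at hw2
  obtain ⟨M, hM, h⟩ := hd.exists_bound_outer_terms (w := w) hq ht1.1 ht2.1
  have hgs : Summable fun n : ℕ => M * (q * t * w) ^ n :=
    (summable_geometric_of_lt_one (by positivity) hqtw).mul_left _
  refine ⟨?_, Summable.of_norm_bounded hgs (h z₀ hz₀ hvt.le hw1.le)⟩
  set U : Set ℂ := {z | 1 < ‖z‖ ∧ 1 < ‖z‖ ^ 2 * t ∧ ‖z‖ ^ 2 < w} with hU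
  have hUo : IsOpen U := by
    have hc : Continuous fun z : ℂ => ‖z‖ ^ 2 * t := by fun_prop
    exact (isOpen_lt continuous_const continuous_norm).inter
      ((isOpen_lt continuous_const hc).inter (isOpen_normSq_lt w))
  have hsum : DifferentiableOn ℂ (fun z => ∑' n, beta a b z n * outerRem a b z n) U := by
    refine Complex.differentiableOn_tsum_of_summable_norm hgs (fun n => ?_) hUo
      (fun n z hz => h z hz.1 hz.2.1.le hz.2.2.le n)
    intro z hz
    have h1 := hd.differentiableAt_outerLim hq hq1 hz.1
    have h2 := (differentiable_gcC a b n).1 z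
    have h3 := differentiable_beta a b n z
    refine DifferentiableAt.differentiableWithinAt ?_
    unfold outerRem
    fun_prop
  exact ((differentiableAt_const 1).sub (hd.differentiableAt_outerLim hq hq1 hz₀)).add
    (hsum.differentiableAt (hUo.mem_nhds ⟨hz₀, hvt, hw1⟩))

/-- The identity behind the continuation. -/
lemma Decay.gcLim_eq (hd : Decay a b K q) (hq : 0 ≤ q) (hw : 1 < w) (hqw : q * w < 1) {z : ℂ}
    (hz : ‖z‖ ^ 2 ≤ w) : gcLim a b z = outer a b z + outerLim a b z * B a b z := by
  have h1 := hd.summable_terms hq hw hqw hz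
  have h2 := (hd.summable_bTerm hq hw hqw hz).mul_left (outerLim a b z)
  have e : ∀ n, beta a b z n * outerRem a b z n
      = beta a b z n * gcC a b z n + outerLim a b z * bTerm a b z n := by
    intro n
    rw [outerRem, bTerm_eq]
    ring
  rw [outer, tsum_congr e, h1.tsum_add h2, tsum_mul_left, B, gcLim]
  ring

end Outer

/-- The extension of the combination across the circle `‖z‖ = R`. -/
noncomputable def outerComb (a b : ℕ → ℝ) (z : ℂ) : ℂ :=
  (1 - z ^ 2) / Real.exp (logTail a 0) * outer a b z

/-! ### Gluing the two expressions -/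

section Radius

variable {a b : ℕ → ℝ} {R : ℝ≥0∞}

lemma exists_decay_annulus (h : HasDecayRate a b R) (hR : R⁻¹ < 1) {z : ℂ} (hz1 : 1 < ‖z‖)
    (hz : ‖z‖ₑ < R ^ 2) :
    ∃ K q : ℝ, 0 < q ∧ q < 1 ∧ q * ‖z‖ < 1 ∧ Decay a b K q :=
  exists_decay h hR (by linarith) (by rwa [← enorm_eq])

lemma combination_eq_outerComb (h : HasDecayRate a b R) (hR : R⁻¹ < 1) {z : ℂ} (hz1 : 1 < ‖z‖)
    (hz : ‖z‖ₑ < R) : combination a b (jostFn a b) z = outerComb a b z := by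
  obtain ⟨K, q, w, hq, hq1, hw, hqw, hzw, hd⟩ := exists_decay_disk h hR hz
  have hz0 : z ≠ 0 := norm_pos_iff.1 (by linarith)
  have hz2 : z ^ 2 - 1 ≠ 0 := by
    intro h0
    have := congrArg norm (sub_eq_zero.1 h0)
    rw [norm_one, norm_pow] at this
    nlinarith
  have hX : outerLim a b z * (1 - z ^ 2) = -(z ^ 2 * gcLim a b z⁻¹) := by
    rw [outerLim]
    have : 1 - z⁻¹ ^ 2 = (z ^ 2 - 1) / z ^ 2 := by field_simp
    rw [this]
    field_simp
    ring
  have h1 := hd.gcLim_eq hq.le hw hqw hzw.le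
  rw [combination_jostFn, outerComb, jostFn, jostFn]
  have hE : (Real.exp (logTail a 0) : ℂ) ≠ 0 := by exact_mod_cast (Real.exp_pos _).ne'
  generalize gcLim a b z⁻¹ = g at hX ⊢
  field_simp
  linear_combination (1 - z ^ 2) * h1 + B a b z * hX

lemma analyticOnNhd_outerComb (h : HasDecayRate a b R) (hR : R⁻¹ < 1) :
    AnalyticOnNhd ℂ (outerComb a b) {z | 1 < ‖z‖ ∧ ‖z‖ₑ < R ^ 2} := by
  refine DifferentiableOn.analyticOnNhd (fun z hz => ?_)
    ((isOpen_lt continuous_const continuous_norm).inter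
      (isOpen_lt continuous_enorm continuous_const))
  obtain ⟨K, q, hq, hq1, hqz, hd⟩ := exists_decay_annulus h hR hz.1 hz.2
  have h1 := (hd.outer_regular hq hq1 hz.1 hqz).1
  refine DifferentiableAt.differentiableWithinAt ?_
  unfold outerComb
  fun_prop

/-- The two analytic pieces agree on the overlap 1 < |z| < R. -/
lemma exists_extension (h : HasDecayRate a b R) (hR : R⁻¹ < 1) :
    ∃ F : ℂ → ℂ, AnalyticOnNhd ℂ F (annulus R⁻¹ (R ^ 2)) ∧
      Set.EqOn F (combination a b (jostFn a b)) (annulus R⁻¹ R) := by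
  classical
  refine ⟨fun z => if ‖z‖ₑ < R then combination a b (jostFn a b) z else outerComb a b z,
    fun z hz => ?_, fun z hz => if_pos hz.2⟩
  by_cases hzR : ‖z‖ₑ < R
  · refine (analyticOnNhd_combination h hR z ⟨hz.1, hzR⟩).congr ?_
    filter_upwards [(isOpen_lt continuous_enorm continuous_const).mem_nhds hzR] with y hy
    exact (if_pos hy).symm
  · have hz1 : 1 < ‖z‖ := by
      have := (one_lt_radius hR).trans_le (not_lt.1 hzR)
      rwa [enorm_eq, ENNReal.one_lt_ofReal] at this
    refine (analyticOnNhd_outerComb h hR z ⟨hz1, hz.2⟩).congr ?_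
    filter_upwards [(isOpen_lt continuous_const continuous_norm).mem_nhds hz1] with y hy
    split_ifs with hyR
    · exact (combination_eq_outerComb h hR hy hyR).symm
    · rfl

end Radius

/-! ### Optimality of R² -/

section Optimality

/-- For real `x > 1` and nonpositive `b`, `a = 1`, all quantities are real with a sign. -/
lemma gcPair_pos {b : ℕ → ℝ} (hb : ∀ n, b (n + 1) ≤ 0) {x : ℝ} (hx : 1 < x) (n : ℕ) :
    ∃ c g : ℝ, gcC (fun _ => 1) b x n = c ∧ gcG (fun _ => 1) b x n = g ∧
      x ^ (2 * n) ≤ c ∧ 1 ≤ g := by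
  induction n with
  | zero => exact ⟨1, 1, by simp, by simp, by simp, le_rfl⟩
  | succ n ih =>
    obtain ⟨c, g, hc, hg, hc1, hg1⟩ := ih
    have hx0 : 0 < x := by linarith
    have hc0 : 0 < c := lt_of_lt_of_le (by positivity) hc1
    have hbx : 0 ≤ -b (n + 1) * x := mul_nonneg (by linarith [hb n]) hx0.le
    refine ⟨(x ^ 2 - b (n + 1) * x) * c + g, -b (n + 1) * x * c + g, ?_, ?_, ?_, ?_⟩
    · rw [gcC_succ, hc, hg]; push_cast; ring
    · rw [gcG_succ, hc, hg, beta]; push_cast; ring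
    · have : x ^ (2 * (n + 1)) ≤ x ^ 2 * c := by
        rw [show 2 * (n + 1) = 2 + 2 * n by ring, pow_add]
        gcongr
      nlinarith [mul_nonneg hbx hc0.le]
    · nlinarith [mul_nonneg hbx hc0.le]

/-- C_n/x^{2n} increases to X with n-th increment at least p^{n+1}/x, so C_n - x^{2n} X ≤ -x^{2n}
p^{n+1}/x; multiply by β_n = p^{n+1} x. -/
lemma outer_real_le {b : ℕ → ℝ} {K q p : ℝ} (hp : 0 < p) (hb : ∀ n, b n = -p ^ n)
    (hd : Decay (fun _ => 1) b K q) (hq : 0 < q) (hq1 : q < 1) {x : ℝ} (hx : 1 < x) (n : ℕ) :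
    ∃ r : ℝ, beta (fun _ => 1) b x n * outerRem (fun _ => 1) b x n = (r : ℂ) ∧
      r ≤ -(p ^ 2 * (p * x) ^ (2 * n)) := by
  have hb' : ∀ n, b (n + 1) ≤ 0 := fun n => by rw [hb]; simp only [Left.neg_nonpos_iff]; positivity
  have hx0 : 0 < x := by linarith
  choose c g hc hg hc1 hg1 using gcPair_pos hb' hx
  have hxn : 1 < ‖(x : ℂ)‖ := by rwa [Complex.norm_real, Real.norm_of_nonneg hx0.le]
  have hlim := hd.tendsto_outerLim hq hq1 hxn
  set E : ℕ → ℝ := fun n => c n / x ^ (2 * n) with hE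
  have hEC : ∀ n, gcC (fun _ => 1) b x n / (x : ℂ) ^ (2 * n) = (E n : ℂ) := by
    intro n
    rw [hc]
    push_cast [hE]
    rfl
  simp only [hEC] at hlim
  have hcs : ∀ n, c (n + 1) = (x ^ 2 - b (n + 1) * x) * c n + g n := by
    intro n
    have := gcC_succ (fun _ => 1) b x n
    rw [hc, hc, hg] at this
    exact_mod_cast this
  have hEs : ∀ n, E n + p ^ (n + 1) / x ≤ E (n + 1) := by
    intro n
    have h1 : E (n + 1) - E n = (p ^ (n + 1) * x * c n + g n) / x ^ (2 * (n + 1)) := by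
      simp only [hE, hcs, hb]
      field_simp
      ring
    have h2 : p ^ (n + 1) / x ≤ (p ^ (n + 1) * x * c n + g n) / x ^ (2 * (n + 1)) := by
      rw [div_le_div_iff₀ hx0 (by positivity)]
      have h3 : p ^ (n + 1) * x * x ^ (2 * n) ≤ p ^ (n + 1) * x * c n := by
        gcongr
        exact hc1 n
      have h4 : p ^ (n + 1) * x * x ^ (2 * n) ≤ p ^ (n + 1) * x * c n + g n := by
        linarith [hg1 n]
      calc p ^ (n + 1) * x ^ (2 * (n + 1)) = p ^ (n + 1) * x * x ^ (2 * n) * x := by ring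
        _ ≤ _ := by gcongr
    linarith
  have hmono : Monotone E := monotone_nat_of_le_succ fun n => by
    have : 0 ≤ p ^ (n + 1) / x := by positivity
    linarith [hEs n]
  have hre : Tendsto E atTop (𝓝 (outerLim (fun _ => 1) b x).re) := by
    have := (Complex.continuous_re.tendsto _).comp hlim
    exact this.congr fun n => by simp
  have hXreal : outerLim (fun _ => 1) b x = ((outerLim (fun _ => 1) b x).re : ℂ) :=
    tendsto_nhds_unique hlim ((Complex.continuous_ofReal.tendsto _).comp hre)
  set X := (outerLim (fun _ => 1) b x).re with hXdef
  have hX : E n + p ^ (n + 1) / x ≤ X := (hEs n).trans (hmono.ge_of_tendsto hre (n + 1))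
  refine ⟨p ^ (n + 1) * x * (c n - x ^ (2 * n) * X), ?_, ?_⟩
  · rw [outerRem, hXreal, hc, beta, hb]
    push_cast
    ring
  · have h1 : c n = x ^ (2 * n) * E n := by
      simp only [hE]
      field_simp
    have h2 : x ^ (2 * n) * (E n - X) ≤ x ^ (2 * n) * (-(p ^ (n + 1) / x)) := by
      gcongr
      linarith
    calc p ^ (n + 1) * x * (c n - x ^ (2 * n) * X)
        = p ^ (n + 1) * x * (x ^ (2 * n) * (E n - X)) := by rw [h1]; ring
      _ ≤ p ^ (n + 1) * x * (x ^ (2 * n) * (-(p ^ (n + 1) / x))) := by gcongr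
      _ = -(p ^ 2 * (p * x) ^ (2 * n)) := by rw [mul_pow]; field_simp; ring

end Optimality

lemma hasDecayRate_geometric {r : ℝ} (hr : 1 < r) :
    HasDecayRate (fun _ => 1) (fun n => -((r ^ 2)⁻¹) ^ n) (ENNReal.ofReal r) := by
  have hr0 : 0 < r := by linarith
  have : (fun n : ℕ => ENNReal.ofReal ((|(1 : ℝ) ^ 2 - 1| + |(-((r ^ 2)⁻¹) ^ n : ℝ)|) ^
      (1 / (2 * (n : ℝ))))) =ᶠ[atTop] fun _ => (ENNReal.ofReal r)⁻¹ := by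
    filter_upwards [eventually_gt_atTop 0] with n hn
    have hn' : (n : ℝ) ≠ 0 := by positivity
    have e : |(1 : ℝ) ^ 2 - 1| + |(-((r ^ 2)⁻¹) ^ n : ℝ)| = r⁻¹ ^ ((2 * n : ℕ) : ℝ) := by
      rw [abs_neg, abs_of_pos (a := ((r ^ 2)⁻¹) ^ n) (by positivity), Real.rpow_natCast, pow_mul, inv_pow]
      simp
    rw [e, ← Real.rpow_mul (by positivity), ← ENNReal.ofReal_inv_of_pos hr0]
    push_cast
    rw [mul_one_div_cancel (by positivity), Real.rpow_one]
  rw [HasDecayRate, limsup_congr this, limsup_const]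

/-- An extension would be continuous at r², where the remainder series diverges to -∞ along the real
axis from the left. -/
lemma not_exists_extension {r : ℝ} (hr : 1 < r) {ρ : ℝ≥0∞} (hρ : ENNReal.ofReal r ^ 2 < ρ) :
    ¬ ∃ F : ℂ → ℂ, AnalyticOnNhd ℂ F (annulus (ENNReal.ofReal r)⁻¹ ρ) ∧
      Set.EqOn F (combination (fun _ => 1) (fun n => -((r ^ 2)⁻¹) ^ n)
        (jostFn (fun _ => 1) (fun n => -((r ^ 2)⁻¹) ^ n)))
        (annulus (ENNReal.ofReal r)⁻¹ (ENNReal.ofReal r)) := by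
  rintro ⟨F, hF, hFe⟩
  set a : ℕ → ℝ := fun _ => 1
  set p : ℝ := (r ^ 2)⁻¹ with hp
  set b : ℕ → ℝ := fun n => -p ^ n
  have hr0 : 0 < r := by linarith
  have hr2 : 1 < r ^ 2 := one_lt_pow₀ hr two_ne_zero
  have hp0 : 0 < p := by positivity
  have hpr : p * r ^ 2 = 1 := inv_mul_cancel₀ (by positivity)
  have h : HasDecayRate a b (ENNReal.ofReal r) := hasDecayRate_geometric hr
  have hR : (ENNReal.ofReal r)⁻¹ < 1 := by rwa [ENNReal.inv_lt_one, ENNReal.one_lt_ofReal]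
  have hann : ∀ z : ℂ, 1 < ‖z‖ → (ENNReal.ofReal r)⁻¹ < ‖z‖ₑ := fun z hz =>
    hR.trans (by rwa [enorm_eq, ENNReal.one_lt_ofReal])
  have hlt2 : ∀ z : ℂ, ‖z‖ < r ^ 2 → ‖z‖ₑ < ENNReal.ofReal r ^ 2 := fun z hz => by
    rwa [enorm_eq, ← ENNReal.ofReal_pow hr0.le, ENNReal.ofReal_lt_ofReal_iff (by positivity)]
  -- A convex set containing the interval (1, r²), so the identity theorem applies directly.
  set U : Set ℂ := {z | 1 < z.re} ∩ Metric.ball 0 (r ^ 2) with hU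
  have hU1 : ∀ z ∈ U, 1 < ‖z‖ := fun z hz =>
    lt_of_lt_of_le hz.1 ((le_abs_self _).trans (Complex.abs_re_le_norm z))
  have hU2 : ∀ z ∈ U, ‖z‖ₑ < ENNReal.ofReal r ^ 2 := fun z hz =>
    hlt2 z (by simpa using hz.2)
  have hUconn : IsPreconnected U :=
    ((convex_halfSpace_re_gt 1).inter (convex_ball 0 (r ^ 2))).isPreconnected
  have hreal : ∀ x : ℝ, 1 < x → x < r ^ 2 → (x : ℂ) ∈ U := fun x hx1 hx2 => by
    refine ⟨by simpa using hx1, ?_⟩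
    rw [mem_ball_zero_iff, Complex.norm_real, Real.norm_of_nonneg (by linarith)]
    exact hx2
  obtain ⟨x₀, hx₀1, hx₀r⟩ := exists_between hr
  have hx₀U : (x₀ : ℂ) ∈ U := hreal x₀ hx₀1 (by nlinarith)
  have hEq : Set.EqOn F (outerComb a b) U := by
    refine AnalyticOnNhd.eqOn_of_preconnected_of_eventuallyEq
      (fun z hz => hF z ⟨hann z (hU1 z hz), (hU2 z hz).trans hρ⟩)
      (fun z hz => analyticOnNhd_outerComb h hR z ⟨hU1 z hz, hU2 z hz⟩) hUconn hx₀U ?_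
    have hx₀n : ‖(x₀ : ℂ)‖ = x₀ := by
      rw [Complex.norm_real, Real.norm_of_nonneg (by linarith)]
    have ho : IsOpen {z : ℂ | 1 < ‖z‖ ∧ ‖z‖ < r} :=
      (isOpen_lt continuous_const continuous_norm).inter
        (isOpen_lt continuous_norm continuous_const)
    filter_upwards [ho.mem_nhds ⟨by rwa [hx₀n], by rwa [hx₀n]⟩] with z hz
    have hzr : ‖z‖ₑ < ENNReal.ofReal r := by
      rw [enorm_eq, ENNReal.ofReal_lt_ofReal_iff hr0]
      exact hz.2
    rw [hFe ⟨hann z hz.1, hzr⟩, combination_eq_outerComb h hR hz.1 hzr]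
  have hn2 : ‖((r ^ 2 : ℝ) : ℂ)‖ = r ^ 2 := by
    rw [Complex.norm_real, Real.norm_of_nonneg (by positivity)]
  have hFc : ContinuousAt F ((r ^ 2 : ℝ) : ℂ) := by
    refine (hF _ ⟨hann _ (by rwa [hn2]), ?_⟩).continuousAt
    rwa [enorm_eq, hn2, ENNReal.ofReal_pow hr0.le]
  obtain ⟨K, q₁, hq0, hq1, -, hd⟩ := exists_decay h hR one_pos
    (by rw [ENNReal.ofReal_one]; exact one_lt_pow₀ (one_lt_radius hR) two_ne_zero)
  have hofr : Tendsto (fun x : ℝ => (x : ℂ)) (𝓝[<] (r ^ 2)) (𝓝 ((r ^ 2 : ℝ) : ℂ)) :=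
    (Complex.continuous_ofReal.tendsto _).mono_left nhdsWithin_le_nhds
  have hE : (Real.exp (logTail a 0) : ℂ) ≠ 0 := by exact_mod_cast (Real.exp_pos _).ne'
  have hne : (1 - ((r ^ 2 : ℝ) : ℂ) ^ 2) / Real.exp (logTail a 0) ≠ 0 := by
    refine div_ne_zero (sub_ne_zero.2 fun h0 => ?_) hE
    have h1 : (1 : ℝ) = (r ^ 2) ^ 2 := by exact_mod_cast h0
    nlinarith
  have hX : ContinuousAt (outerLim a b) ((r ^ 2 : ℝ) : ℂ) :=
    (hd.differentiableAt_outerLim hq0 hq1 (by rwa [hn2])).continuousAt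
  -- On U this equals the remainder series, but it is continuous at r² too.
  set L : ℂ → ℂ := fun z =>
    F z / ((1 - z ^ 2) / Real.exp (logTail a 0)) - (1 - outerLim a b z)
  have hLc : ContinuousAt L ((r ^ 2 : ℝ) : ℂ) := by
    refine (hFc.div ?_ hne).sub (continuousAt_const.sub hX)
    fun_prop
  have hLlim : Tendsto (fun x : ℝ => (L x).re) (𝓝[<] (r ^ 2)) (𝓝 (L ((r ^ 2 : ℝ) : ℂ)).re) :=
    (Complex.continuous_re.tendsto _).comp (hLc.tendsto.comp hofr)
  have hev : ∀ᶠ x : ℝ in 𝓝[<] (r ^ 2), 1 < x ∧ x < r ^ 2 := Ioo_mem_nhdsLT hr2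
  have hle : ∀ N : ℕ, ∀ x : ℝ, 1 < x → x < r ^ 2 →
      (L x).re ≤ ∑ n ∈ Finset.range N, -(p ^ 2 * (p * x) ^ (2 * n)) := by
    intro N x hx1 hx2
    have hxU := hreal x hx1 hx2
    obtain ⟨K', q', hq0', hq1', hqz', hd'⟩ := exists_decay_annulus h hR (hU1 _ hxU) (hU2 _ hxU)
    have hsum := (hd'.outer_regular hq0' hq1' (hU1 _ hxU) hqz').2
    have hnex : (1 - (x : ℂ) ^ 2) / Real.exp (logTail a 0) ≠ 0 := by
      refine div_ne_zero (sub_ne_zero.2 fun h0 => ?_) hE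
      have h1 : (1 : ℝ) = x ^ 2 := by exact_mod_cast h0
      nlinarith
    have hLx : L x = ∑' n, beta a b x n * outerRem a b x n := by
      simp only [L]
      rw [hEq hxU, outerComb, mul_div_cancel_left₀ _ hnex, outer, add_sub_cancel_left]
    choose s hs1 hs2 using outer_real_le hp0 (fun _ => rfl) hd hq0 hq1 hx1
    have hsum' : Summable s := by
      rw [← Complex.summable_ofReal]
      exact hsum.congr hs1
    rw [hLx, tsum_congr hs1, ← Complex.ofReal_tsum, Complex.ofReal_re]
    have hneg : ∀ n, s n ≤ 0 := fun n => (hs2 n).trans (by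
      have : 0 < x := by linarith
      simp only [Left.neg_nonpos_iff]
      positivity)
    have h1 := hsum'.neg.sum_le_tsum (Finset.range N) fun n _ => neg_nonneg.2 (hneg n)
    rw [tsum_neg, Finset.sum_neg_distrib] at h1
    exact (neg_le_neg_iff.1 h1).trans (Finset.sum_le_sum fun n _ => hs2 n)
  -- As x → r², p x → 1, so each of the first N terms contributes -p² to the bound.
  have hbound : ∀ N : ℕ, (L ((r ^ 2 : ℝ) : ℂ)).re ≤ -(N * p ^ 2) := by
    intro N
    have hc : Continuous fun x : ℝ => ∑ n ∈ Finset.range N, -(p ^ 2 * (p * x) ^ (2 * n)) := by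
      fun_prop
    have h1 := le_of_tendsto_of_tendsto hLlim
      ((hc.tendsto (r ^ 2)).mono_left nhdsWithin_le_nhds)
      (hev.mono fun x hx => hle N x hx.1 hx.2)
    simpa [hpr] using h1
  obtain ⟨N, hN⟩ := exists_nat_gt (-(L ((r ^ 2 : ℝ) : ℂ)).re / p ^ 2)
  rw [div_lt_iff₀ (by positivity)] at hN
  linarith [hbound N]

end JacobiJost

theorem theorem1p5 :
    -- analyticity of the combination in the annulus `R⁻¹ < |z| < R²`
    (∀ (a b : ℕ → ℝ) (R : ℝ≥0∞), (∀ n : ℕ, 1 ≤ n → 0 < a n) →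
      JacobiJost.HasDecayRate a b R → R⁻¹ < 1 →
      (∀ z : ℂ, ‖z‖ₑ < R → Summable (JacobiJost.bTerm a b z)) ∧
      ∃ u : ℂ → ℂ, JacobiJost.IsJostFunction a b u ∧
        AnalyticOnNhd ℂ u {z : ℂ | ‖z‖ₑ < R} ∧
        ∃ F : ℂ → ℂ, AnalyticOnNhd ℂ F (JacobiJost.annulus R⁻¹ (R ^ 2)) ∧
          Set.EqOn F (JacobiJost.combination a b u) (JacobiJost.annulus R⁻¹ R)) ∧
    -- the radius `R²` cannot be replaced by a larger one
    (∀ R : ℝ≥0∞, R⁻¹ < 1 → R ≠ ⊤ →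
      ∃ (a b : ℕ → ℝ) (u : ℂ → ℂ), (∀ n : ℕ, 1 ≤ n → 0 < a n) ∧
        JacobiJost.HasDecayRate a b R ∧ JacobiJost.IsJostFunction a b u ∧
        AnalyticOnNhd ℂ u {z : ℂ | ‖z‖ₑ < R} ∧
        ∀ ρ : ℝ≥0∞, R ^ 2 < ρ →
          ¬ ∃ F : ℂ → ℂ, AnalyticOnNhd ℂ F (JacobiJost.annulus R⁻¹ ρ) ∧
            Set.EqOn F (JacobiJost.combination a b u) (JacobiJost.annulus R⁻¹ R)) := by
  refine ⟨fun a b R ha h hR => ⟨fun z hz => JacobiJost.summable_bTerm h hR hz,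
    JacobiJost.jostFn a b, JacobiJost.isJostFunction_jostFn ha h hR,
    JacobiJost.analyticOnNhd_jostFn h hR, JacobiJost.exists_extension h hR⟩, fun R hR hRt => ?_⟩
  obtain ⟨r, hr0, rfl⟩ : ∃ r : ℝ, 0 ≤ r ∧ R = ENNReal.ofReal r :=
    ⟨R.toReal, ENNReal.toReal_nonneg, (ENNReal.ofReal_toReal hRt).symm⟩
  have hr : 1 < r := ENNReal.one_lt_ofReal.1 (JacobiJost.one_lt_radius hR)
  have ha : ∀ n : ℕ, 1 ≤ n → (0 : ℝ) < (fun _ : ℕ => 1) n := fun _ _ => one_pos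
  have h := JacobiJost.hasDecayRate_geometric hr
  exact ⟨_, _, _, ha, h, JacobiJost.isJostFunction_jostFn ha h hR,
    JacobiJost.analyticOnNhd_jostFn h hR, fun ρ hρ => JacobiJost.not_exists_extension hr hρ⟩
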